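/- Let $$\bar r(t)=\tfrac{44}{59}-\tfrac{24}{119}\cos 2t+\tfrac{2}{49}\cos 4t-\tfrac{1}{110}\cos 6t+\tfrac{1}{468}\cos 8t,\qquad t\in\mathbb R .$$ Then the differential equation $$r'=-r+(\cos 2t+\sin 2t+2)\,r^3$$ has a $2\pi$-periodic solution $r^*:\mathbb R\to\mathbb R$ with $$\|\bar r-r^*\|_\infty=\sup_{t\in\mathbb R}|\bar r(t)-r^*(t)|\le 0.0192 .$$ The solution $r^*$ is hyperbolic, that is, the Poincaré map $P$, which sends the value at time $0$ of a solution to its value at time $2\pi$, is well defined near $r^*(0)$ and differentiable at its fixed point $r^*(0)$, with $|P'(r^*(0))|\neq 1$. The solution $r^*$ is also unstable, that is, it is not Lyapunov stable forward in time: there is $\varepsilon>0$ such that for every $\delta>0$ some solution $\varphi$ on an interval $[0,b]$ satisfies $|\varphi(0)-r^*(0)|<\delta$ and $|\varphi(t)-r^*(t)|\ge\varepsilon$ for some $t\in[0,b]$. Moreover, $r^*$ is the unique periodic solution of the equation, of any period $T>0$, contained in this strip: if $q:\mathbb R\to\mathbb R$ is a periodic solution with $\|\bar r-q\|_\infty\le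 0.0192$, then $q=r^*$. -/

import Mathlib

noncomputable section

namespace PeriodicODE

/-- `φ` solves the scalar equation `x' = X(x, t)` on the set `s` of times
(the derivative is one-sided at the endpoints of an interval). -/
def SolvesOn (X : ℝ → ℝ → ℝ) (s : Set ℝ) (φ : ℝ → ℝ) : Prop :=
  ∀ t ∈ s, HasDerivWithinAt φ (X (φ t) t) s t

/-- `r` is a solution of `x' = X(x, t)` on the whole real line that is periodic with period `T`. -/
def IsPeriodicSolution (X : ℝ → ℝ → ℝ) (T : ℝ) (r : ℝ → ℝ) : Prop :=
  SolvesOn X Set.univ r ∧ Function.Periodic r T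

/-- Some solution of `x' = X(x, t)` on `[0, T]` takes the value `x` at time `0`
and the value `y` at time `T`. -/
def Transports (X : ℝ → ℝ → ℝ) (T x y : ℝ) : Prop :=
  ∃ φ : ℝ → ℝ, SolvesOn X (Set.Icc 0 T) φ ∧ φ 0 = x ∧ φ T = y

/-- `P` is the Poincaré (time `T`) map of `x' = X(x, t)` near `x₀`: for every `x` close to `x₀`
the solutions starting at `x` at time `0` exist on `[0, T]`, and all end at `P x`. -/
def IsPoincareMapNear (X : ℝ → ℝ → ℝ) (T x₀ : ℝ) (P : ℝ → ℝ) : Prop :=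
  ∀ᶠ x in nhds x₀, ∀ y : ℝ, Transports X T x y ↔ y = P x

/-- The `T`-periodic solution `r` is hyperbolic: the Poincaré map near its fixed point `r 0`
is defined and differentiable at `r 0`, with a multiplier off the unit circle. -/
def IsHyperbolic (X : ℝ → ℝ → ℝ) (T : ℝ) (r : ℝ → ℝ) : Prop :=
  ∃ (P : ℝ → ℝ) (m : ℝ), IsPoincareMapNear X T (r 0) P ∧ HasDerivAt P m (r 0) ∧ |m| ≠ 1

/-- The solution `r` is Lyapunov stable, forward in time: solutions starting close to it
at time `0` stay close to it for as long as they exist. -/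
def IsLyapunovStable (X : ℝ → ℝ → ℝ) (r : ℝ → ℝ) : Prop :=
  ∀ ε > 0, ∃ δ > 0, ∀ (b : ℝ) (φ : ℝ → ℝ), SolvesOn X (Set.Icc 0 b) φ →
    |φ 0 - r 0| < δ → ∀ t ∈ Set.Icc 0 b, |φ t - r t| < ε

/-- The solution `r` is unstable: it is not Lyapunov stable. Concretely, there is an `ε > 0` such
that arbitrarily close to `r 0` there start solutions that reach distance `ε` from `r`. -/
def IsUnstable (X : ℝ → ℝ → ℝ) (r : ℝ → ℝ) : Prop :=
  ¬ IsLyapunovStable X r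

/-- The graph of `q` lies in the strip of half-width `ρ` around the graph of `f`,
that is, `‖f - q‖_∞ ≤ ρ`. -/
def InStrip (f : ℝ → ℝ) (ρ : ℝ) (q : ℝ → ℝ) : Prop :=
  ∀ t : ℝ, |f t - q t| ≤ ρ

/-- The right-hand side `X(r, t) = -r + (cos 2t + sin 2t + 2) r³`. -/
def ellipseField (r t : ℝ) : ℝ :=
  -r + (Real.cos (2 * t) + Real.sin (2 * t) + 2) * r ^ 3

/-- The approximate periodic solution. -/
def rBar (t : ℝ) : ℝ :=
  44 / 59 - 24 / 119 * Real.cos (2 * t) + 2 / 49 * Real.cos (4 * t)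
    - 1 / 110 * Real.cos (6 * t) + 1 / 468 * Real.cos (8 * t)

end PeriodicODE

end

/-!
The equation `r' = -r + c(t) r³`, with `c(t) = cos 2t + sin 2t + 2`, is of Bernoulli type: for a
positive solution, `u = r⁻²` satisfies the linear equation `u' = 2u - 2c(t)`, which has the general
solution `u(t) = 2 + cos 2t + s e^{2t}`. Hence the positive solutions are the functions
`bernoulliSolution s`, and `s = 0` gives the periodic solution `r*(t) = (2 + cos 2t)^{-1/2}` in
closed form.

All the claims are read off from this formula.

* Strip: with `x = cos 2t`, the approximation `rBar` is a polynomial `p(x)`, and the residual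
  `(2 + x) p(x)² - 1` is small on `[-1, 1]` (`abs_residual_le`); so is
  `|p(x) - (2 + x)^{-1/2}|`.
* Hyperbolicity: the solution starting at `x` has parameter `s = x⁻² - 3`, so the Poincaré map is
  `x ↦ (3 + (x⁻² - 3) e^{4π})^{-1/2}`, whose derivative at `r*(0) = 3^{-1/2}` is `e^{4π} > 1`.
  That no other solution starts at `x` is `eqOn_of_solvesOn`.
* Instability: for every `s > 0` the solution tends to `0` as `t → ∞`, whereas `r* ≥ 3^{-1/2}`.
* Uniqueness: a solution `q` in the strip is bounded below by a positive constant, so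
  `q⁻² - (2 + cos 2t)` is a bounded solution of `w' = 2w` on the whole line, hence zero.
-/

namespace PeriodicODE

open Real Set Filter Topology

/-! ### The explicit solutions -/

/-- The substituted unknown `u = r⁻²`: the general solution of `u' = 2u - 2(cos 2t + sin 2t + 2)`,
with parameter `s`. -/
noncomputable def bernoulliU (s t : ℝ) : ℝ := 2 + cos (2 * t) + s * exp (2 * t)

/-- The positive solution of `x' = ellipseField x t` belonging to `bernoulliU s`; it is a solution
only where `bernoulliU s` is positive. -/
noncomputable def bernoulliSolution (s t : ℝ) : ℝ := (√(bernoulliU s t))⁻¹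

lemma hasDerivAt_bernoulliU (s t : ℝ) :
    HasDerivAt (bernoulliU s) (2 * bernoulliU s t - 2 * (cos (2 * t) + sin (2 * t) + 2)) t := by
  have h2 : HasDerivAt (fun t : ℝ => 2 * t) 2 t := by
    simpa using (hasDerivAt_id t).const_mul (2 : ℝ)
  have := ((h2.cos.const_add 2).add (h2.exp.const_mul s))
  refine this.congr_deriv ?_
  simp only [bernoulliU]
  ring

lemma hasDerivAt_bernoulliSolution {s t : ℝ} (h : 0 < bernoulliU s t) :
    HasDerivAt (bernoulliSolution s) (ellipseField (bernoulliSolution s t) t) t := by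
  have hw : 0 < √(bernoulliU s t) := sqrt_pos.2 h
  refine (((hasDerivAt_bernoulliU s t).sqrt h.ne').inv hw.ne').congr_deriv ?_
  have hsq : bernoulliU s t = √(bernoulliU s t) ^ 2 := (sq_sqrt h.le).symm
  simp only [ellipseField, bernoulliSolution]
  set w := √(bernoulliU s t)
  rw [hsq]
  field_simp
  ring

lemma one_le_bernoulliU_zero (t : ℝ) : 1 ≤ bernoulliU 0 t := by
  have := neg_one_le_cos (2 * t)
  simp only [bernoulliU]
  linarith

lemma bernoulliU_pos {s t : ℝ} (hs : 0 ≤ s) : 0 < bernoulliU s t := by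
  have h := one_le_bernoulliU_zero t
  have : 0 ≤ s * exp (2 * t) := by positivity
  simp only [bernoulliU] at *
  linarith

lemma solvesOn_bernoulliSolution {s : ℝ} {I : Set ℝ} (h : ∀ t ∈ I, 0 < bernoulliU s t) :
    SolvesOn ellipseField I (bernoulliSolution s) :=
  fun t ht => (hasDerivAt_bernoulliSolution (h t ht)).hasDerivWithinAt

lemma isPeriodicSolution_bernoulliSolution_zero :
    IsPeriodicSolution ellipseField (2 * π) (bernoulliSolution 0) := by
  refine ⟨solvesOn_bernoulliSolution fun t _ => bernoulliU_pos le_rfl, fun t => ?_⟩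
  have : cos (2 * (t + 2 * π)) = cos (2 * t) := by
    rw [show 2 * (t + 2 * π) = 2 * t + (2 : ℕ) * (2 * π) by push_cast; ring, cos_add_nat_mul_two_pi]
  simp [bernoulliSolution, bernoulliU, this]

/-- Solutions of the initial value problem are unique: the difference of two solutions satisfies a
linear homogeneous equation with bounded coefficient. -/
lemma eqOn_of_solvesOn {b : ℝ} {φ ψ : ℝ → ℝ} (hφ : SolvesOn ellipseField (Icc 0 b) φ)
    (hψ : SolvesOn ellipseField (Icc 0 b) ψ) (h0 : φ 0 = ψ 0) : EqOn φ ψ (Icc 0 b) := by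
  have cφ : ContinuousOn φ (Icc 0 b) := fun t ht => (hφ t ht).continuousWithinAt
  have cψ : ContinuousOn ψ (Icc 0 b) := fun t ht => (hψ t ht).continuousWithinAt
  have ca : ContinuousOn (fun t => -1 + (cos (2 * t) + sin (2 * t) + 2) *
      (φ t ^ 2 + φ t * ψ t + ψ t ^ 2)) (Icc 0 b) := by fun_prop
  obtain ⟨K, hK⟩ := isCompact_Icc.exists_bound_of_continuousOn ca
  intro t ht
  refine sub_eq_zero.1 (eq_zero_of_abs_deriv_le_mul_abs_self_of_eq_zero_right
    (f := fun t => φ t - ψ t) (f' := fun t => ellipseField (φ t) t - ellipseField (ψ t) t)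
    (K := K) (cφ.sub cψ) (fun x hx => ?_) (sub_eq_zero.2 h0) (fun x hx => ?_) t ht)
  · have hm : Icc 0 b ∈ 𝓝[≥] x := mem_of_superset (Icc_mem_nhdsGE hx.2) (Icc_subset_Icc_left hx.1)
    exact ((hφ x (Ico_subset_Icc_self hx)).sub
      (hψ x (Ico_subset_Icc_self hx))).mono_of_mem_nhdsWithin hm
  · have e : ellipseField (φ x) x - ellipseField (ψ x) x =
        (-1 + (cos (2 * x) + sin (2 * x) + 2) * (φ x ^ 2 + φ x * ψ x + ψ x ^ 2)) *
          (φ x - ψ x) := by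
      simp only [ellipseField]; ring
    rw [e, norm_mul]
    exact mul_le_mul_of_nonneg_right (hK x (Ico_subset_Icc_self hx)) (norm_nonneg _)

/-! ### The approximate solution -/

/-- The polynomial `p` with `rBar t = p (cos 2t)`. -/
noncomputable def rBarPoly (x : ℝ) : ℝ :=
  44 / 59 - 24 / 119 * x + 2 / 49 * (2 * x ^ 2 - 1) - 1 / 110 * (4 * x ^ 3 - 3 * x)
    + 1 / 468 * (8 * x ^ 4 - 8 * x ^ 2 + 1)

lemma rBar_eq_rBarPoly (t : ℝ) : rBar t = rBarPoly (cos (2 * t)) := by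
  have h4 : cos (4 * t) = 2 * cos (2 * t) ^ 2 - 1 := by rw [← cos_two_mul]; ring_nf
  have h6 : cos (6 * t) = 4 * cos (2 * t) ^ 3 - 3 * cos (2 * t) := by
    rw [← cos_three_mul]; ring_nf
  have h8 : cos (8 * t) = 8 * cos (2 * t) ^ 4 - 8 * cos (2 * t) ^ 2 + 1 := by
    rw [show 8 * t = 2 * (4 * t) by ring, cos_two_mul, h4]; ring
  rw [rBar, rBarPoly, h4, h6, h8]

lemma rBarPoly_ge {x : ℝ} (h₁ : -1 ≤ x) (h₂ : x ≤ 1) : 2 / 5 ≤ rBarPoly x := by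
  have hy : x ^ 2 ≤ 1 := by nlinarith
  have h3 : x ^ 3 ≤ 1 := by nlinarith [sq_nonneg x]
  have h4 : 0 ≤ x ^ 4 := by positivity
  simp only [rBarPoly]
  nlinarith [sq_nonneg x]

/-- The residual of the approximation in the equation `(2 + x) r² = 1` for the exact solution. -/
lemma abs_residual_le {x : ℝ} (h₁ : -1 ≤ x) (h₂ : x ≤ 1) :
    |(2 + x) * rBarPoly x ^ 2 - 1| ≤ 1 / 40 := by
  have hx : |x| ≤ 1 := abs_le.2 ⟨h₁, h₂⟩
  have hy0 : 0 ≤ x ^ 2 := sq_nonneg x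
  have hy1 : x ^ 2 ≤ 1 := by nlinarith
  -- The coefficients of degrees 1, 3, 5 are the large ones, and they nearly cancel.
  obtain ⟨a, ha⟩ : ∃ a, a = 0.0067 - 0.0262 * x ^ 2 + 0.0197 * (x ^ 2) ^ 2 := ⟨_, rfl⟩
  have hA : |a| ≤ 0.007 := by
    rw [abs_le]; constructor <;> nlinarith [sq_nonneg (x ^ 2 - 0.664)]
  have hB : |x * a| ≤ 0.007 := by
    rw [abs_mul]; nlinarith [abs_nonneg a, abs_nonneg x]
  have p (n : ℕ) : |x ^ n| ≤ 1 := by rw [abs_pow]; exact pow_le_one₀ (abs_nonneg x) hx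
  have p1 := abs_le.1 hx
  have p2 := abs_le.1 (p 2)
  have p3 := abs_le.1 (p 3)
  have p4 := abs_le.1 (p 4)
  have p5 := abs_le.1 (p 5)
  have p6 := abs_le.1 (p 6)
  have p7 := abs_le.1 (p 7)
  have p8 := abs_le.1 (p 8)
  have p9 := abs_le.1 (p 9)
  have hB' := abs_le.1 hB
  have e : x * a = 0.0067 * x - 0.0262 * x ^ 3 + 0.0197 * x ^ 5 := by rw [ha]; ring
  rw [e] at hB'
  simp only [rBarPoly]
  rw [abs_le]
  constructor <;> ring_nf <;> linarith

lemma inStrip_bernoulliSolution_zero : InStrip rBar 0.0192 (bernoulliSolution 0) := by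
  intro t
  have hc₁ := neg_one_le_cos (2 * t)
  have hc₂ := cos_le_one (2 * t)
  have hR := abs_residual_le hc₁ hc₂
  have hp := rBarPoly_ge hc₁ hc₂
  rw [rBar_eq_rBarPoly]
  have hU := one_le_bernoulliU_zero t
  have hs1 : 1 ≤ √(bernoulliU 0 t) := one_le_sqrt.2 hU
  have hs2 : √(bernoulliU 0 t) ^ 2 = 2 + cos (2 * t) := by
    rw [sq_sqrt (by linarith)]; simp [bernoulliU]
  simp only [bernoulliSolution]
  set w := √(bernoulliU 0 t)
  set y := rBarPoly (cos (2 * t))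
  rw [← hs2] at hR
  have hwy : 2 / 5 ≤ w * y := by nlinarith
  -- Factor `w² y² - 1 = (w y - 1) (w y + 1)`, with second factor at least `7 / 5`.
  have hd : |w * y - 1| ≤ 0.0192 := by
    rw [show w ^ 2 * y ^ 2 - 1 = (w * y - 1) * (w * y + 1) by ring, abs_mul,
      abs_of_nonneg (by linarith : (0 : ℝ) ≤ w * y + 1)] at hR
    nlinarith [abs_nonneg (w * y - 1)]
  have hw : 0 < w := by linarith
  rw [show y - w⁻¹ = (w * y - 1) / w by field_simp, abs_div, abs_of_pos hw]
  exact (div_le_self (abs_nonneg _) hs1).trans hd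

/-! ### Hyperbolicity -/

lemma bernoulliU_zero_zero : bernoulliU 0 0 = 3 := by
  norm_num [bernoulliU]

/-- The initial value `x > 0` belongs to the parameter `s = x⁻² - 3`. -/
lemma bernoulliSolution_initial {x : ℝ} (hx : 0 < x) :
    bernoulliSolution ((x ^ 2)⁻¹ - 3) 0 = x := by
  have : bernoulliU ((x ^ 2)⁻¹ - 3) 0 = (x ^ 2)⁻¹ := by
    simp only [bernoulliU, mul_zero, cos_zero, exp_zero]; ring
  rw [bernoulliSolution, this, sqrt_inv, sqrt_sq hx.le, inv_inv]

lemma transports_iff {b x : ℝ} (hb : 0 ≤ b) (hx : 0 < x)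
    (hU : ∀ t ∈ Icc 0 b, 0 < bernoulliU ((x ^ 2)⁻¹ - 3) t) (y : ℝ) :
    Transports ellipseField b x y ↔ y = bernoulliSolution ((x ^ 2)⁻¹ - 3) b := by
  have hsol := solvesOn_bernoulliSolution hU
  have h0 := bernoulliSolution_initial hx
  constructor
  · rintro ⟨φ, hφ, rfl, rfl⟩
    exact eqOn_of_solvesOn hφ hsol h0.symm ⟨hb, le_rfl⟩
  · rintro rfl
    exact ⟨_, hsol, h0, rfl⟩

lemma isHyperbolic_bernoulliSolution_zero :
    IsHyperbolic ellipseField (2 * π) (bernoulliSolution 0) := by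
  have hr0 : bernoulliSolution 0 0 = (√3)⁻¹ := by rw [bernoulliSolution, bernoulliU_zero_zero]
  have h3 : (0 : ℝ) < √3 := by positivity
  have hsq : √3 ^ 2 = (3 : ℝ) := sq_sqrt (by norm_num)
  have hpos : (0 : ℝ) < (√3)⁻¹ := inv_pos.2 h3
  have hs0 : (((√3)⁻¹ ^ 2)⁻¹ - 3 : ℝ) = 0 := by rw [inv_pow, inv_inv, hsq, sub_self]
  refine ⟨fun x => bernoulliSolution ((x ^ 2)⁻¹ - 3) (2 * π), exp (2 * (2 * π)), ?_, ?_, ?_⟩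
  · rw [IsPoincareMapNear, hr0]
    have hc : ContinuousAt (fun x : ℝ => ((x ^ 2)⁻¹ - 3) * exp (2 * (2 * π))) (√3)⁻¹ := by
      have : ((√3)⁻¹ ^ 2 : ℝ) ≠ 0 := by positivity
      fun_prop (disch := exact this)
    have hev : ∀ᶠ x in 𝓝 (√3)⁻¹, -1 < ((x ^ 2)⁻¹ - 3) * exp (2 * (2 * π)) := by
      refine hc.eventually_const_lt ?_
      simp only [hs0]; norm_num
    filter_upwards [hev, lt_mem_nhds hpos] with x hx hx0
    refine transports_iff (by positivity) hx0 fun t ht => ?_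
    rcases le_total 0 ((x ^ 2)⁻¹ - 3) with hs | hs
    · exact bernoulliU_pos hs
    · -- For negative `s` the term `s e^{2t}` decreases, so its value at `2π` is the worst.
      have hexp : exp (2 * t) ≤ exp (2 * (2 * π)) := exp_le_exp.2 (by linarith [ht.2])
      have := neg_one_le_cos (2 * t)
      have := mul_le_mul_of_nonpos_left hexp hs
      simp only [bernoulliU]
      linarith
  · rw [hr0]
    have hcos : cos (2 * (2 * π)) = 1 := by
      have := cos_nat_mul_two_pi 2
      simpa using this
    have hx2 : ((√3)⁻¹ ^ 2 : ℝ) ≠ 0 := by positivity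
    have h1 : HasDerivAt (fun x : ℝ => bernoulliU ((x ^ 2)⁻¹ - 3) (2 * π))
        (-(2 * (√3)⁻¹) / ((√3)⁻¹ ^ 2) ^ 2 * exp (2 * (2 * π))) (√3)⁻¹ := by
      have := ((((hasDerivAt_pow 2 ((√3)⁻¹ : ℝ)).inv hx2).sub_const 3).mul_const
        (exp (2 * (2 * π)))).const_add (2 + cos (2 * (2 * π)))
      refine this.congr_deriv ?_
      norm_num
    have hval : bernoulliU (((√3)⁻¹ ^ 2)⁻¹ - 3) (2 * π) = 3 := by
      rw [hs0, bernoulliU, hcos]; norm_num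
    have h2 := (h1.sqrt (by rw [hval]; norm_num)).inv (by rw [hval]; exact h3.ne')
    refine h2.congr_deriv ?_
    rw [hval]
    field_simp
  · have h := one_lt_exp_iff.2 (show 0 < 2 * (2 * π) by positivity)
    rw [abs_of_pos (exp_pos _)]
    exact h.ne'

/-! ### Instability -/

lemma isUnstable_bernoulliSolution_zero : IsUnstable ellipseField (bernoulliSolution 0) := by
  intro hst
  obtain ⟨δ, hδ, H⟩ := hst (1 / 4) (by norm_num)
  have hc : ContinuousAt (fun s => bernoulliSolution s 0) 0 := by
    have hne : √(bernoulliU 0 0) ≠ 0 := (sqrt_pos.2 (bernoulliU_pos le_rfl)).ne'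
    have : ContinuousAt (fun s => bernoulliU s 0) 0 := by unfold bernoulliU; fun_prop
    exact this.sqrt.inv₀ hne
  obtain ⟨η, hη, hs⟩ := Metric.continuousAt_iff.1 hc δ hδ
  set s := η / 2 with hs_def
  have hspos : 0 < s := by positivity
  have hclose : |bernoulliSolution s 0 - bernoulliSolution 0 0| < δ := by
    have := hs (x := s) (by rw [Real.dist_eq, sub_zero, abs_of_pos hspos]; linarith)
    rwa [Real.dist_eq] at this
  -- At this time `s e^{2b} ≥ 16`, so the solution with parameter `s` has come down to `1 / 4`.
  set b := 8 / s with hb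
  have hb0 : 0 ≤ b := by positivity
  have hU : 16 ≤ bernoulliU s b := by
    have h1 : 2 * b ≤ exp (2 * b) := by linarith [add_one_le_exp (2 * b)]
    have h2 : s * (2 * b) = 16 := by rw [hb]; field_simp; norm_num
    have h3 := mul_le_mul_of_nonneg_left h1 hspos.le
    have := neg_one_le_cos (2 * b)
    simp only [bernoulliU]
    linarith
  have hfar := H b (bernoulliSolution s) (solvesOn_bernoulliSolution fun t _ => bernoulliU_pos
    hspos.le) hclose b ⟨hb0, le_rfl⟩
  have hsmall : bernoulliSolution s b ≤ 1 / 4 := by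
    have : (4 : ℝ) ≤ √(bernoulliU s b) := le_sqrt_of_sq_le (by linarith)
    rw [bernoulliSolution, one_div]
    exact inv_anti₀ (by norm_num) this
  have hbig : 1 / 2 ≤ bernoulliSolution 0 b := by
    have hle : √(bernoulliU 0 b) ≤ 2 := by
      refine (sqrt_le_left (by norm_num)).2 ?_
      have := cos_le_one (2 * b)
      simp only [bernoulliU]
      linarith
    rw [bernoulliSolution, one_div]
    exact inv_anti₀ (sqrt_pos.2 (bernoulliU_pos le_rfl)) hle
  linarith [(abs_lt.1 hfar).1]

/-! ### Uniqueness -/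

/-- A solution of `w' = 2w` that is bounded on the whole line vanishes. -/
lemma eq_zero_of_hasDerivAt_two_mul {w : ℝ → ℝ} {C : ℝ} (hw : ∀ t, HasDerivAt w (2 * w t) t)
    (hC : ∀ t, |w t| ≤ C) (t : ℝ) : w t = 0 := by
  have hd : ∀ t, HasDerivAt (fun t => w t * exp (-2 * t)) 0 t := fun t => by
    have h2 : HasDerivAt (fun t : ℝ => -2 * t) (-2) t := by
      simpa using (hasDerivAt_id t).const_mul (-2 : ℝ)
    refine ((hw t).mul h2.exp).congr_deriv ?_
    ring
  have hconst : ∀ x, w t * exp (-2 * t) = w x * exp (-2 * x) := fun x =>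
    is_const_of_deriv_eq_zero (fun t => (hd t).differentiableAt) (fun t => (hd t).deriv) t x
  have hlim : Tendsto (fun x : ℝ => w x * exp (-2 * x)) atTop (𝓝 0) := by
    refine bdd_le_mul_tendsto_zero' C (Eventually.of_forall hC) ?_
    exact tendsto_exp_atBot.comp (tendsto_id.const_mul_atTop_of_neg (by norm_num))
  have h0 : w t * exp (-2 * t) = 0 :=
    tendsto_nhds_unique (tendsto_const_nhds.congr hconst) hlim
  exact (mul_eq_zero.1 h0).resolve_right (exp_pos _).ne'

/-- Periodicity is not needed here: any solution on the whole line that stays in the strip is the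
periodic one. -/
lemma eq_bernoulliSolution_zero {q : ℝ → ℝ} (hq : SolvesOn ellipseField univ q)
    (hstrip : InStrip rBar 0.0192 q) : q = bernoulliSolution 0 := by
  have hq3 : ∀ t, 1 / 3 ≤ q t := fun t => by
    have h1 := rBarPoly_ge (neg_one_le_cos (2 * t)) (cos_le_one (2 * t))
    rw [← rBar_eq_rBarPoly] at h1
    have h2 := (abs_le.1 (hstrip t)).2
    norm_num at h2
    linarith
  have hpos : ∀ t, 0 < q t := fun t => lt_of_lt_of_le (by norm_num) (hq3 t)
  have hw : ∀ t, (q t ^ 2)⁻¹ - bernoulliU 0 t = 0 := by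
    refine eq_zero_of_hasDerivAt_two_mul (C := 12) (fun t => ?_) fun t => ?_
    · have hd : HasDerivAt q (ellipseField (q t) t) t := by simpa using hq t (mem_univ t)
      have hne := (hpos t).ne'
      refine (((hd.fun_pow 2).fun_inv (pow_ne_zero 2 hne)).sub
        (hasDerivAt_bernoulliU 0 t)).congr_deriv ?_
      simp only [ellipseField]
      field_simp
      ring
    · have h1 : (q t ^ 2)⁻¹ ≤ 9 := by
        rw [inv_le_comm₀ (pow_pos (hpos t) 2) (by norm_num)]
        nlinarith [hq3 t]
      have h2 : 0 ≤ (q t ^ 2)⁻¹ := by positivity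
      have h3 := one_le_bernoulliU_zero t
      have h4 : bernoulliU 0 t ≤ 3 := by
        have := cos_le_one (2 * t)
        simp only [bernoulliU]
        linarith
      rw [abs_le]
      constructor <;> linarith
  funext t
  rw [bernoulliSolution, ← sub_eq_zero.1 (hw t), sqrt_inv, sqrt_sq (hpos t).le, inv_inv]

end PeriodicODE

theorem mainTheorem3 :
    ∃ r : ℝ → ℝ,
      PeriodicODE.IsPeriodicSolution PeriodicODE.ellipseField (2 * Real.pi) r ∧
      PeriodicODE.InStrip PeriodicODE.rBar 0.0192 r ∧
      PeriodicODE.IsHyperbolic PeriodicODE.ellipseField (2 * Real.pi) r ∧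
      PeriodicODE.IsUnstable PeriodicODE.ellipseField r ∧
      ∀ (T : ℝ) (q : ℝ → ℝ), 0 < T →
        PeriodicODE.IsPeriodicSolution PeriodicODE.ellipseField T q →
        PeriodicODE.InStrip PeriodicODE.rBar 0.0192 q → q = r :=
  ⟨PeriodicODE.bernoulliSolution 0, PeriodicODE.isPeriodicSolution_bernoulliSolution_zero,
    PeriodicODE.inStrip_bernoulliSolution_zero, PeriodicODE.isHyperbolic_bernoulliSolution_zero,
    PeriodicODE.isUnstable_bernoulliSolution_zero,
    fun _ _ _ hq hstrip => PeriodicODE.eq_bernoulliSolution_zero hq.1 hstrip⟩
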